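/- Let $H,K$ be complex Hilbert spaces with $\dim H>1$. Write $B(H)$ for the algebra of bounded linear operators on $H$ and $F(H)$ for the ideal of bounded finite rank operators; a (complex) subalgebra of $B(H)$, not necessarily unital or closed, is called a standard operator algebra if it contains $F(H)$. Let $\mathcal A\subset B(H)$ and $\mathcal B\subset B(K)$ be standard operator algebras which are closed under taking adjoints, and let $\phi:\mathcal A\to\mathcal B$ be a bijective map (not assumed additive) satisfying \[ \phi(A^*)=\phi(A)^*,\qquad \phi(AB+BA)=\phi(A)\phi(B)+\phi(B)\phi(A) \] for all $A,B\in\mathcal A$. Then at least one of the following holds: (i) there is a unitary operator $U:H\to K$ such that $\phi(A)=UAU^*$ for all $A\in\mathcal A$; (ii) there is an antiunitary operator $U:H\to K$ such that $\phi(A)=UAU^*$ for all $A\in\mathcal A$; (iii) there is a unitary operator $U:H\to K$ such that $\phi(A)=UA^*U^*$ for all $A\in\mathcal A$; (iv) there is an antiunitary operator $U:H\to K$ such that $\phi(A)=UA^*U^*$ for all $A\in\mathcal A$. In particular, $\phi$ is additive. (A unitary, respectively antiunitary, operator is a linear, respectively conjugate-linear, surjective isometry, and $U^*=U^{-1}$.)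 -/

import Mathlib

/-- The bounded operator `T` has finite rank: its range is finite dimensional. -/
def HasFiniteRank {H : Type*} [NormedAddCommGroup H] [InnerProductSpace ℂ H]
    (T : H →L[ℂ] H) : Prop :=
  FiniteDimensional ℂ (LinearMap.range (T : H →ₗ[ℂ] H))

/-- An adjoint-closed (not necessarily unital or closed) subalgebra of `B(H)` is a standard
operator algebra if it contains every bounded finite rank operator.  The star of `H →L[ℂ] H`
is the Hilbert space adjoint, so a `NonUnitalStarSubalgebra` is exactly a complex subalgebra
closed under taking adjoints. -/
def IsStandardOperatorAlgebra {H : Type*} [NormedAddCommGroup H] [InnerProductSpace ℂ H]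
    [CompleteSpace H] (𝒜 : NonUnitalStarSubalgebra ℂ (H →L[ℂ] H)) : Prop :=
  ∀ T : H →L[ℂ] H, HasFiniteRank T → T ∈ 𝒜

/-- `U A U*` for a unitary operator `U : H → K`, that is, a linear isometry of `H` onto `K`.
Here `U* = U⁻¹`, see `unitary_inner_symm`. -/
noncomputable def unitaryConj {H K : Type*} [NormedAddCommGroup H] [InnerProductSpace ℂ H]
    [NormedAddCommGroup K] [InnerProductSpace ℂ K]
    (U : H ≃ₗᵢ[ℂ] K) (A : H →L[ℂ] H) : K →L[ℂ] K :=
  (U.toContinuousLinearEquiv : H →L[ℂ] K).comp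
    (A.comp (U.symm.toContinuousLinearEquiv : K →L[ℂ] H))

/-- `U A U*` for an antiunitary operator `U : H → K`, that is, a conjugate-linear isometry of
`H` onto `K`.  Here `U* = U⁻¹`, see `antiunitary_inner_symm`. -/
noncomputable def antiunitaryConj {H K : Type*} [NormedAddCommGroup H] [InnerProductSpace ℂ H]
    [NormedAddCommGroup K] [InnerProductSpace ℂ K]
    (U : H ≃ₗᵢ⋆[ℂ] K) (A : H →L[ℂ] H) : K →L[ℂ] K :=
  (U.toContinuousLinearEquiv : H →L⋆[ℂ] K).comp
    (A.comp (U.symm.toContinuousLinearEquiv : K →L⋆[ℂ] H))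

/-- The inverse of a unitary operator is its adjoint. -/
theorem unitary_inner_symm {H K : Type*} [NormedAddCommGroup H] [InnerProductSpace ℂ H]
    [NormedAddCommGroup K] [InnerProductSpace ℂ K]
    (U : H ≃ₗᵢ[ℂ] K) (x : H) (y : K) :
    inner ℂ (U x) y = inner ℂ x (U.symm y) := by
  rw [← U.inner_map_map x (U.symm y), U.apply_symm_apply]

/-- The inverse of an antiunitary operator is its adjoint, in the sense of conjugate-linear
operators. -/
theorem antiunitary_inner_symm {H K : Type*} [NormedAddCommGroup H] [InnerProductSpace ℂ H]
    [NormedAddCommGroup K] [InnerProductSpace ℂ K]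
    (U : H ≃ₗᵢ⋆[ℂ] K) (x : H) (y : K) :
    inner ℂ (U x) y = inner ℂ (U.symm y) x := by
  obtain ⟨z, rfl⟩ := U.surjective y
  rw [U.symm_apply_apply]
  have hre : ∀ a b : H, (inner ℂ (U a) (U b)).re = (inner ℂ a b).re := by
    intro a b
    have h1 := norm_add_sq (𝕜 := ℂ) (U a) (U b)
    have h2 := norm_add_sq (𝕜 := ℂ) a b
    rw [← map_add, U.norm_map, U.norm_map, U.norm_map] at h1
    simp only [RCLike.re_to_complex] at h1 h2
    linarith
  have hsymm : (inner ℂ z x).re = (inner ℂ x z).re := by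
    rw [← inner_conj_symm, Complex.conj_re]
  have hsymm' : (inner ℂ z x).im = -(inner ℂ x z).im := by
    rw [← inner_conj_symm, Complex.conj_im]
  apply Complex.ext
  · rw [hre, hsymm]
  · have h := hre (Complex.I • x) z
    rw [map_smulₛₗ, inner_smul_left, inner_smul_left] at h
    simp at h
    rw [hsymm', ← h, neg_neg]

/-! The proof has two stages: additivity from the Jordan identity alone (with the star), then a
classification of additive Jordan star maps that never uses homogeneity.

Additivity. Write s∘t for st + ts and fix the projection p onto a line ℂe. If φ(s) = φ(a) + φ(b),
then φ(s∘t) = φ(a∘t) + φ(b∘t) for every t. When t annihilates one summand, or additivity is already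
known for the products, injectivity turns this into an equation for s∘t. Rank one operators supply
enough t to force s = a + b, one Peirce block at a time. Here dim H > 1 provides a nonzero
off-diagonal operator, which is needed inside the corner pAp.

Structure. Since φ(p) is again a rank one projection, each off-diagonal φ(ap - pap) lies on one side
of φ(p), and by additivity on the same side for all a. So φ carries Ap into Bφ(p) or into φ(p)B;
composing with the star reduces the second case to the first. On Ap the map is then multiplicative,
φ(a(bp)) = φ(a)φ(bp). Identifying Ap with H by x ↦ |x⟩⟨e|, and likewise for K, this restriction
becomes a map U with φ(a)U = Ua. On pAp = ℂp it is a star-preserving ring endomorphism of ℂ, that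
is, the identity or conjugation, so U is linear or conjugate-linear. -/

/-! ### Peirce decomposition relative to a projection -/

section Peirce

variable {R : Type*} [NonUnitalRing R] {p a b : R} {i j k : Bool}

/-- `a` lies in the Peirce component of `p` with the given left and right indices, where `true`
stands for `p` and `false` for its complement. -/
def IsPeirce (p : R) (i j : Bool) (a : R) : Prop :=
  p * a = cond i a 0 ∧ a * p = cond j a 0

theorem IsPeirce.add (ha : IsPeirce p i j a) (hb : IsPeirce p i j b) : IsPeirce p i j (a + b) := by
  cases i <;> cases j <;> simp_all [IsPeirce, mul_add, add_mul]

theorem IsPeirce.sub (ha : IsPeirce p i j a) (hb : IsPeirce p i j b) : IsPeirce p i j (a - b) := by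
  cases i <;> cases j <;> simp_all [IsPeirce, mul_sub, sub_mul]

theorem IsPeirce.zero : IsPeirce p i j 0 := by
  cases i <;> cases j <;> simp [IsPeirce]

theorem IsPeirce.mul (ha : IsPeirce p i j a) (hb : IsPeirce p j k b) : IsPeirce p i k (a * b) := by
  refine ⟨?_, ?_⟩
  · rw [← mul_assoc, ha.1]; cases i <;> simp
  · rw [mul_assoc, hb.2]; cases k <;> simp

theorem IsPeirce.mul_eq_zero {j' : Bool} (ha : IsPeirce p i j a) (hb : IsPeirce p j' k b)
    (hj : j ≠ j') : a * b = 0 := by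
  have h : a * (p * b) = a * p * b := (mul_assoc ..).symm
  rw [ha.2, hb.1] at h
  cases j <;> cases j' <;> simp_all

theorem IsPeirce.star [StarRing R] (hp : star p = p) (ha : IsPeirce p i j a) :
    IsPeirce p j i (star a) := by
  have h1 := congrArg Star.star ha.1
  have h2 := congrArg Star.star ha.2
  rw [star_mul, hp] at h1 h2
  refine ⟨?_, ?_⟩
  · rw [h2]; cases j <;> simp
  · rw [h1]; cases i <;> simp

/-- Without a unit, 1 - p is only formal; the four pieces are the expansions of psp, ps(1-p),
(1-p)sp and (1-p)s(1-p). -/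
theorem exists_isPeirce (hp : p * p = p) (s : R) : ∃ s₁ s₂ s₃ s₄ : R, s = s₁ + s₂ + s₃ + s₄ ∧
    IsPeirce p true true s₁ ∧ IsPeirce p true false s₂ ∧
    IsPeirce p false true s₃ ∧ IsPeirce p false false s₄ := by
  have hp' (x : R) : p * (p * x) = p * x := by rw [← mul_assoc, hp]
  refine ⟨p * s * p, p * s - p * s * p, s * p - p * s * p, s - p * s - s * p + p * s * p,
    by abel, ?_, ?_, ?_, ?_⟩ <;>
    simp [IsPeirce, mul_sub, sub_mul, mul_add, add_mul, mul_assoc, hp, hp']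

theorem isPeirce_ext {s₁ s₂ s₃ s₄ t₁ t₂ t₃ t₄ : R} (h : s₁ + s₂ + s₃ + s₄ = t₁ + t₂ + t₃ + t₄)
    (hs₁ : IsPeirce p true true s₁) (hs₂ : IsPeirce p true false s₂)
    (hs₃ : IsPeirce p false true s₃) (hs₄ : IsPeirce p false false s₄)
    (ht₁ : IsPeirce p true true t₁) (ht₂ : IsPeirce p true false t₂)
    (ht₃ : IsPeirce p false true t₃) (ht₄ : IsPeirce p false false t₄) :
    s₁ = t₁ ∧ s₂ = t₂ ∧ s₃ = t₃ ∧ s₄ = t₄ := by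
  have hl := congrArg (fun x => p * x) h
  simp only [mul_add, hs₁.1, hs₂.1, hs₃.1, hs₄.1, ht₁.1, ht₂.1, ht₃.1, ht₄.1, cond_true,
    cond_false, add_zero] at hl
  have h1 := congrArg (fun x => x * p) hl
  simp only [add_mul, hs₁.2, hs₂.2, ht₁.2, ht₂.2, cond_true, cond_false, add_zero] at h1
  have hr := congrArg (fun x => x * p) h
  simp only [add_mul, hs₁.2, hs₂.2, hs₃.2, hs₄.2, ht₁.2, ht₂.2, ht₃.2, ht₄.2, cond_true,
    cond_false, add_zero] at hr
  subst h1
  have h2 := add_left_cancel hl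
  have h3 := add_left_cancel hr
  subst h2 h3
  exact ⟨rfl, rfl, rfl, add_left_cancel h⟩

end Peirce

/-- A projection `p` of a star ring whose Peirce components separate each other well enough to
make Jordan maps additive. -/
structure IsPeirceSeparating {R : Type*} [NonUnitalRing R] [StarRing R] (p : R) : Prop where
  idem : p * p = p
  star_eq : star p = p
  proper : ∀ a : R, star a * a = 0 → a = 0
  eq_zero_of_add_self : ∀ a : R, a + a = 0 → a = 0
  corner : ∀ d : R, (∀ t, IsPeirce p false false t → d * t + t * d = 0) → IsPeirce p true true d
  faithful : ∀ d : R, IsPeirce p false false d →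
    (∀ t, IsPeirce p true false t → t * d = 0) → d = 0
  domain : ∀ d x : R, IsPeirce p true true d → IsPeirce p true false x → d * x = 0 → d = 0 ∨ x = 0
  exists_unit : ∀ a : R, IsPeirce p true false a → ∃ q, IsPeirce p false false q ∧ a * q = a

/-! ### Additivity of Jordan bijections, block by block -/

section Additivity

variable {R S : Type*} [NonUnitalRing R] [NonUnitalRing S] {p : R} {φ : R → S}

theorem jordan_map_zero (hφ : Function.Bijective φ)
    (hj : ∀ a b, φ (a * b + b * a) = φ a * φ b + φ b * φ a) : φ 0 = 0 := by
  obtain ⟨z, hz⟩ := hφ.2 0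
  simpa [hz] using hj 0 z

/-- The engine of the additivity proof: a relation φ(s) = φ(a) + φ(b) survives Jordan multiplication
by any t, and this may be iterated. -/
theorem jordan_split (hj : ∀ a b, φ (a * b + b * a) = φ a * φ b + φ b * φ a) {s a b : R}
    (h : φ s = φ a + φ b) (t : R) :
    φ (s * t + t * s) = φ (a * t + t * a) + φ (b * t + t * b) := by
  rw [hj, hj, hj, h, add_mul, mul_add]; abel

variable [StarRing R]

theorem IsPeirceSeparating.eq_of_mul_star (h : IsPeirceSeparating p) {a b : R}
    (hab : (a - b) * star (a - b) = 0) : a = b := by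
  have := h.proper (star (a - b)) (by simpa using hab)
  rwa [star_eq_zero, sub_eq_zero] at this

/-- `φ` is additive on sums of the two off-diagonal components. -/
theorem IsPeirceSeparating.map_offdiag (h : IsPeirceSeparating p) (hφ : Function.Bijective φ)
    (hj : ∀ a b, φ (a * b + b * a) = φ a * φ b + φ b * φ a) {a b : R}
    (ha : IsPeirce p true false a) (hb : IsPeirce p false true b) :
    φ (a + b) = φ a + φ b := by
  have h0 := jordan_map_zero hφ hj
  obtain ⟨s, hs⟩ := hφ.2 (φ a + φ b)
  have hsplit := jordan_split hj hs
  obtain ⟨s₁, s₂, s₃, s₄, rfl, h₁, h₂, h₃, h₄⟩ := exists_isPeirce h.idem s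
  -- Jordan multiplication by p fixes a and b, hence fixes s. It doubles the upper corner and kills
  -- the lower one, so both corners of s vanish.
  have hsp := hsplit p
  simp only [ha.1, ha.2, hb.1, hb.2, cond_true, cond_false, zero_add, add_zero, ← hs] at hsp
  have hsp := hφ.1 hsp
  simp only [add_mul, mul_add, h₁.1, h₁.2, h₂.1, h₂.2, h₃.1, h₃.2, h₄.1, h₄.2, cond_true,
    cond_false] at hsp
  obtain ⟨h11, -, -, h44⟩ := isPeirce_ext (by rw [← hsp]; abel) (h₁.add h₁) h₂ h₃ .zero h₁ h₂ h₃ h₄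
  obtain rfl : s₁ = 0 := by simpa using h11
  subst h44
  simp only [zero_add, add_zero] at *
  -- The test element (s₃ - b)* annihilates a, and the lower corner of the resulting identity is (s₃
  -- - b)(s₃ - b)* = 0.
  have e₃ : s₃ = b := by
    have ht := (h₃.sub hb).star h.star_eq
    have := hsplit (star (s₃ - b))
    rw [ha.mul_eq_zero ht (by simp), ht.mul_eq_zero ha (by simp), add_zero, h0, zero_add] at this
    have := hφ.1 this
    rw [add_mul, mul_add, h₂.mul_eq_zero ht (by simp), ht.mul_eq_zero h₂ (by simp), zero_add,
      zero_add, ← sub_eq_zero] at this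
    apply h.eq_of_mul_star
    have h4 := (h₃.sub hb).mul ht
    have h1 := ht.mul (h₃.sub hb)
    refine (isPeirce_ext (t₁ := 0) (t₂ := 0) (t₃ := 0) (t₄ := 0) ?_ h1 .zero .zero h4
      .zero .zero .zero .zero).2.2.2
    simp only [add_zero]
    rw [← this]; noncomm_ring
  have e₂ : s₂ = a := by
    have ht := (h₂.sub ha).star h.star_eq
    have := hsplit (star (s₂ - a))
    rw [hb.mul_eq_zero ht (by simp), ht.mul_eq_zero hb (by simp), add_zero, h0, add_zero] at this
    have := hφ.1 this
    rw [add_mul, mul_add, h₃.mul_eq_zero ht (by simp), ht.mul_eq_zero h₃ (by simp), add_zero,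
      add_zero, ← sub_eq_zero] at this
    apply h.eq_of_mul_star
    have h1 := (h₂.sub ha).mul ht
    have h4 := ht.mul (h₂.sub ha)
    refine (isPeirce_ext (t₁ := 0) (t₂ := 0) (t₃ := 0) (t₄ := 0) ?_ h1 .zero .zero h4
      .zero .zero .zero .zero).1
    simp only [add_zero]
    rw [← this]; noncomm_ring
  rw [← hs, e₂, e₃]

/-- `φ` is additive on the sum of the `p`-corner and the off-diagonal part. -/
theorem IsPeirceSeparating.map_corner_add_offdiag (h : IsPeirceSeparating p)
    (hφ : Function.Bijective φ)
    (hj : ∀ a b, φ (a * b + b * a) = φ a * φ b + φ b * φ a) {c a b : R}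
    (hc : IsPeirce p true true c)
    (ha : IsPeirce p true false a) (hb : IsPeirce p false true b) :
    φ (c + (a + b)) = φ c + φ (a + b) := by
  have h0 := jordan_map_zero hφ hj
  obtain ⟨s, hs⟩ := hφ.2 (φ c + φ (a + b))
  have hsplit := jordan_split hj hs
  have hd : IsPeirce p true true (s - (a + b)) := by
    refine h.corner _ fun t ht => ?_
    have := hsplit t
    rw [hc.mul_eq_zero ht (by simp), ht.mul_eq_zero hc (by simp), add_zero, h0, zero_add] at this
    rw [← sub_eq_zero.2 (hφ.1 this)]
    noncomm_ring
  obtain ⟨d, rfl⟩ : ∃ d, s = d + (a + b) := ⟨s - (a + b), by abel⟩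
  rw [add_sub_cancel_right] at hd
  -- The test element b - a is chosen because a² = b² = 0 makes its Jordan product with a + b
  -- vanish, which isolates d - c.
  have hab : (a + b) * (b - a) + (b - a) * (a + b) = 0 := by
    simp only [add_mul, mul_add, sub_mul, mul_sub, ha.mul_eq_zero ha (by simp),
      hb.mul_eq_zero hb (by simp)]
    abel
  have := hsplit (b - a)
  rw [hab, h0, add_zero] at this
  have := hφ.1 this
  have key : (d - c) * (b - a) + (b - a) * (d - c) = 0 := by
    rw [← sub_eq_zero] at this
    rw [← this]
    have e : (d + (a + b)) * (b - a) + (b - a) * (d + (a + b)) - (c * (b - a) + (b - a) * c)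
      = ((d - c) * (b - a) + (b - a) * (d - c)) + ((a + b) * (b - a) + (b - a) * (a + b)) := by
      noncomm_ring
    rw [e, hab, add_zero]
  have hdc := hd.sub hc
  have h2 := hdc.mul ha
  have h3 := hb.mul hdc
  rw [mul_sub, sub_mul b, hdc.mul_eq_zero hb (by simp), ha.mul_eq_zero hdc (by simp)] at key
  have hx := isPeirce_ext (s₁ := 0) (s₄ := 0) (t₁ := 0) (t₂ := 0) (t₄ := 0)
    (t₃ := b * (d - c)) (s₃ := 0) (s₂ := (d - c) * a)
    (by
      simp only [zero_add, add_zero]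
      rw [← sub_eq_zero, ← neg_eq_zero, ← key]; abel) .zero h2 .zero .zero .zero .zero h3 .zero
  rcases h.domain _ _ hdc ha hx.2.1 with h' | rfl
  · rw [← hs, sub_eq_zero.1 h']
  have h5 := congrArg star hx.2.2.1
  rw [star_zero, star_mul] at h5
  rcases h.domain _ _ (hdc.star h.star_eq) (hb.star h.star_eq) h5.symm with h' | h'
  · rw [← hs, sub_eq_zero.1 (star_eq_zero.1 h')]
  · rw [star_eq_zero] at h'
    subst h'
    simp [h0]

/-- `φ` is additive on the sum of the complementary corner and the off-diagonal part. -/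
theorem IsPeirceSeparating.map_compl_add_offdiag (h : IsPeirceSeparating p)
    (hφ : Function.Bijective φ)
    (hj : ∀ a b, φ (a * b + b * a) = φ a * φ b + φ b * φ a) {c a b : R}
    (hc : IsPeirce p false false c)
    (ha : IsPeirce p true false a) (hb : IsPeirce p false true b) :
    φ (c + (a + b)) = φ c + φ (a + b) := by
  have h0 := jordan_map_zero hφ hj
  obtain ⟨s, hs⟩ := hφ.2 (φ c + φ (a + b))
  have hsplit := jordan_split hj hs
  obtain ⟨s₁, s₂, s₃, s₄, rfl, h₁, h₂, h₃, h₄⟩ := exists_isPeirce h.idem s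
  have hsp := hsplit p
  simp only [hc.1, hc.2, cond_false, zero_add, h0] at hsp
  have hsp := hφ.1 hsp
  simp only [add_mul, mul_add, h₁.1, h₁.2, h₂.1, h₂.2, h₃.1, h₃.2, h₄.1, h₄.2, ha.1, ha.2, hb.1,
    hb.2, cond_true, cond_false] at hsp
  obtain ⟨h11, rfl, rfl, -⟩ := isPeirce_ext (t₁ := 0) (t₄ := 0) (t₂ := a) (t₃ := b)
    (by simp only [add_zero, zero_add] at hsp ⊢; rw [add_comm a b, ← hsp]; abel)
    (h₁.add h₁) h₂ h₃ .zero .zero ha hb .zero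
  obtain rfl : s₁ = 0 := h.eq_zero_of_add_self _ h11
  have hsc : s₄ = c := by
    rw [← sub_eq_zero]
    refine h.faithful _ (h₄.sub hc) fun t ht => ?_
    -- Multiplying by t and then by p leaves tc from c and only the corner term 2ts₃ from the
    -- off-diagonal part. Their images add by the previous corner case, giving ts₄ = tc.
    have h1 := jordan_split hj (hsplit t) p
    have e1 : (c * t + t * c) * p + p * (c * t + t * c) = t * c := by
      rw [hc.mul_eq_zero ht (by simp), zero_add, (ht.mul hc).1, (ht.mul hc).2]
      simp
    have e2 : ((s₂ + s₃) * t + t * (s₂ + s₃)) * p + p * ((s₂ + s₃) * t + t * (s₂ + s₃))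
        = t * s₃ + t * s₃ := by
      simp only [add_mul, mul_add, ha.mul_eq_zero ht (by simp), ht.mul_eq_zero ha (by simp),
        (ht.mul hb).1, (ht.mul hb).2, (hb.mul ht).1, (hb.mul ht).2, cond_true, cond_false,
        zero_add]
    have e3 : ((0 + s₂ + s₃ + s₄) * t + t * (0 + s₂ + s₃ + s₄)) * p +
        p * ((0 + s₂ + s₃ + s₄) * t + t * (0 + s₂ + s₃ + s₄)) = t * s₃ + t * s₃ + t * s₄ := by
      have e4 : (0 + s₂ + s₃ + s₄) * t + t * (0 + s₂ + s₃ + s₄) =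
        ((s₂ + s₃) * t + t * (s₂ + s₃)) + t * s₄ := by
        rw [zero_add, add_mul _ s₄, h₄.mul_eq_zero ht (by simp), mul_add _ _ s₄]; abel
      rw [e4, add_mul _ _ p, mul_add p, (ht.mul h₄).1, (ht.mul h₄).2, cond_true, cond_false, ← e2]
      abel
    rw [e1, e2, e3, add_comm (φ _)] at h1
    have h2 := h.map_corner_add_offdiag hφ hj ((ht.mul hb).add (ht.mul hb)) (ht.mul hc) .zero
    rw [add_zero] at h2
    rw [← h2] at h1
    rw [mul_sub, sub_eq_zero]
    exact add_left_cancel (hφ.1 h1)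
  rw [← hs, hsc]
  congr 1; abel

/-- `φ` is additive with respect to the Peirce decomposition. -/
theorem IsPeirceSeparating.map_peirce (h : IsPeirceSeparating p)
    (hφ : Function.Bijective φ)
    (hj : ∀ a b, φ (a * b + b * a) = φ a * φ b + φ b * φ a) {a b c d : R}
    (ha : IsPeirce p true true a) (hb : IsPeirce p true false b)
    (hc : IsPeirce p false true c) (hd : IsPeirce p false false d) :
    φ (a + b + c + d) = φ a + φ b + φ c + φ d := by
  have h0 := jordan_map_zero hφ hj
  have e1 : φ a + φ b + φ c + φ d = φ a + φ (d + (b + c)) := by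
    rw [h.map_compl_add_offdiag hφ hj hd hb hc, h.map_offdiag hφ hj hb hc]; abel
  obtain ⟨s, hs⟩ := hφ.2 (φ a + φ (d + (b + c)))
  have hsplit := jordan_split hj hs
  rw [e1, ← hs]
  have hcor : IsPeirce p true true (s - (d + (b + c))) := by
    refine h.corner _ fun t ht => ?_
    have := hsplit t
    rw [ha.mul_eq_zero ht (by simp), ht.mul_eq_zero ha (by simp), add_zero, h0, zero_add] at this
    rw [← sub_eq_zero.2 (hφ.1 this)]
    noncomm_ring
  obtain ⟨x, rfl⟩ : ∃ x, s = x + (d + (b + c)) := ⟨s - (d + (b + c)), by abel⟩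
  rw [add_sub_cancel_right] at hcor
  have hsp := hsplit p
  have e2 : (d + (b + c)) * p + p * (d + (b + c)) = b + c := by
    simp only [add_mul, mul_add, hb.1, hb.2, hc.1, hc.2, hd.1, hd.2, cond_true, cond_false]
    abel
  have e3 : (x + (d + (b + c))) * p + p * (x + (d + (b + c))) = x + x + (b + c) := by
    rw [add_mul x, mul_add p x, hcor.1, hcor.2, cond_true, add_add_add_comm, e2]
  rw [e2, e3, ha.1, ha.2, cond_true, ← h.map_corner_add_offdiag hφ hj (ha.add ha) hb hc] at hsp
  have hxa := add_right_cancel (hφ.1 hsp)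
  have : x = a := by
    rw [← sub_eq_zero]
    apply h.eq_zero_of_add_self
    rw [← sub_eq_zero.2 hxa]; abel
  rw [this]; congr 1; abel

/-- The sum is itself a Jordan product: if aq = a with q in the lower corner, then (p + a)∘(q + b) =
a + b. Both factors split additively by the earlier cases, and of the four resulting products only
a∘q = a and p∘b = b survive. -/
theorem IsPeirceSeparating.map_upper_add (h : IsPeirceSeparating p)
    (hφ : Function.Bijective φ)
    (hj : ∀ a b, φ (a * b + b * a) = φ a * φ b + φ b * φ a) {a b : R}
    (ha : IsPeirce p true false a) (hb : IsPeirce p true false b) :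
    φ (a + b) = φ a + φ b := by
  obtain ⟨q, hq, haq⟩ := h.exists_unit a ha
  have h0 := jordan_map_zero hφ hj
  have hp : IsPeirce p true true p := ⟨h.idem, h.idem⟩
  have e (x y : R) (hx : IsPeirce p true false x) (hy : IsPeirce p true false y) :
      (p + x) * (q + y) + (q + y) * (p + x) = x * q + y := by
    simp only [add_mul, mul_add, hp.mul_eq_zero hq (by simp), hq.mul_eq_zero hp (by simp),
      hx.mul_eq_zero hy (by simp), hy.mul_eq_zero hx (by simp), hq.mul_eq_zero hx (by simp),
      hy.mul_eq_zero hp (by simp), hy.1, cond_true]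
    abel
  have e1 := h.map_corner_add_offdiag hφ hj hp ha .zero
  have e2 := h.map_compl_add_offdiag hφ hj hq hb .zero
  rw [add_zero] at e1 e2
  have h1 := hj (p + a) (q + b)
  have h2 := hj p q
  have h3 := hj p b
  have h4 := hj a q
  have h5 := hj a b
  rw [hp.mul_eq_zero hq (by simp), hq.mul_eq_zero hp (by simp), add_zero, h0] at h2
  rw [hb.1, hb.mul_eq_zero hp (by simp), cond_true, add_zero] at h3
  rw [haq, hq.mul_eq_zero ha (by simp), add_zero] at h4
  rw [ha.mul_eq_zero hb (by simp), hb.mul_eq_zero ha (by simp), add_zero, h0] at h5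
  rw [e a b ha hb, haq, e1, e2] at h1
  calc φ (a + b) = _ := h1
    _ = (φ p * φ q + φ q * φ p) + (φ p * φ b + φ b * φ p) + (φ a * φ q + φ q * φ a) +
        (φ a * φ b + φ b * φ a) := by noncomm_ring
    _ = φ a + φ b := by rw [← h2, ← h3, ← h4, ← h5]; abel

/-- Multiplication by a nonzero off-diagonal x moves the question to the upper off-diagonal block,
where additivity is known; `domain` then cancels x. -/
theorem IsPeirceSeparating.map_corner_add (h : IsPeirceSeparating p)
    (hφ : Function.Bijective φ)
    (hj : ∀ a b, φ (a * b + b * a) = φ a * φ b + φ b * φ a) (hnt : ∃ x, IsPeirce p true false x ∧ x ≠ 0)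
    {a b : R}
    (ha : IsPeirce p true true a) (hb : IsPeirce p true true b) :
    φ (a + b) = φ a + φ b := by
  have h0 := jordan_map_zero hφ hj
  obtain ⟨s, hs⟩ := hφ.2 (φ a + φ b)
  have hsplit := jordan_split hj hs
  have hcor : IsPeirce p true true s := by
    refine h.corner _ fun t ht => ?_
    have := hsplit t
    rw [ha.mul_eq_zero ht (by simp), ht.mul_eq_zero ha (by simp), hb.mul_eq_zero ht (by simp),
      ht.mul_eq_zero hb (by simp), add_zero, h0, zero_add, ← h0] at this
    exact hφ.1 this
  obtain ⟨x, hx, hx0⟩ := hnt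
  have := hsplit x
  rw [hx.mul_eq_zero hcor (by simp), hx.mul_eq_zero ha (by simp), hx.mul_eq_zero hb (by simp),
    add_zero, add_zero, add_zero, ← h.map_upper_add hφ hj (ha.mul hx) (hb.mul hx), ← add_mul] at this
  have := hφ.1 this
  rw [← sub_eq_zero, ← sub_mul] at this
  have := (h.domain _ _ (hcor.sub (ha.add hb)) hx this).resolve_right hx0
  rw [← hs, sub_eq_zero.1 this]

theorem IsPeirceSeparating.map_compl_add (h : IsPeirceSeparating p)
    (hφ : Function.Bijective φ)
    (hj : ∀ a b, φ (a * b + b * a) = φ a * φ b + φ b * φ a) {a b : R}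
    (ha : IsPeirce p false false a) (hb : IsPeirce p false false b) :
    φ (a + b) = φ a + φ b := by
  have h0 := jordan_map_zero hφ hj
  obtain ⟨s, hs⟩ := hφ.2 (φ a + φ b)
  have hsplit := jordan_split hj hs
  obtain ⟨s₁, s₂, s₃, s₄, rfl, h₁, h₂, h₃, h₄⟩ := exists_isPeirce h.idem s
  have hsp := hsplit p
  simp only [ha.1, ha.2, hb.1, hb.2, cond_false, add_zero, h0] at hsp
  have hsp := hφ.1 (hsp.trans h0.symm)
  simp only [add_mul, mul_add, h₁.1, h₁.2, h₂.1, h₂.2, h₃.1, h₃.2, h₄.1, h₄.2,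
    cond_true, cond_false] at hsp
  obtain ⟨h11, rfl, rfl, -⟩ := isPeirce_ext (t₁ := 0) (t₄ := 0) (t₂ := 0) (t₃ := 0)
    (by simp only [add_zero] at hsp ⊢; rw [← hsp]; abel)
    (h₁.add h₁) h₂ h₃ .zero .zero .zero .zero .zero
  obtain rfl : s₁ = 0 := h.eq_zero_of_add_self _ h11
  simp only [zero_add, add_zero] at *
  suffices hsc : s₄ = a + b by rw [← hs, hsc]
  rw [← sub_eq_zero]
  refine h.faithful _ (h₄.sub (ha.add hb)) fun t ht => ?_
  have := hsplit t
  rw [h₄.mul_eq_zero ht (by simp), ha.mul_eq_zero ht (by simp), hb.mul_eq_zero ht (by simp),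
    zero_add, zero_add, zero_add, ← h.map_upper_add hφ hj (ht.mul ha) (ht.mul hb)] at this
  rw [mul_sub, mul_add, sub_eq_zero]
  exact hφ.1 this

/-- A bijective star-preserving Jordan map on a star ring with a separating projection is
additive. -/
theorem IsPeirceSeparating.map_add [StarRing S] (h : IsPeirceSeparating p)
    (hφ : Function.Bijective φ) (hstar : ∀ a, φ (star a) = star (φ a))
    (hj : ∀ a b, φ (a * b + b * a) = φ a * φ b + φ b * φ a)
    (hnt : ∃ x, IsPeirce p true false x ∧ x ≠ 0) (a b : R) :
    φ (a + b) = φ a + φ b := by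
  obtain ⟨a₁, a₂, a₃, a₄, rfl, ha₁, ha₂, ha₃, ha₄⟩ := exists_isPeirce h.idem a
  obtain ⟨b₁, b₂, b₃, b₄, rfl, hb₁, hb₂, hb₃, hb₄⟩ := exists_isPeirce h.idem b
  have e : a₁ + a₂ + a₃ + a₄ + (b₁ + b₂ + b₃ + b₄) =
    (a₁ + b₁) + (a₂ + b₂) + (a₃ + b₃) + (a₄ + b₄) := by abel
  -- The star exchanges the two off-diagonal blocks.
  have h3 : φ (a₃ + b₃) = φ a₃ + φ b₃ := by
    have := h.map_upper_add hφ hj (ha₃.star h.star_eq) (hb₃.star h.star_eq)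
    rw [← star_add, hstar, hstar, hstar, ← star_add] at this
    exact star_injective this
  rw [e, h.map_peirce hφ hj (ha₁.add hb₁) (ha₂.add hb₂) (ha₃.add hb₃) (ha₄.add hb₄),
    h.map_peirce hφ hj ha₁ ha₂ ha₃ ha₄, h.map_peirce hφ hj hb₁ hb₂ hb₃ hb₄,
    h.map_corner_add hφ hj hnt ha₁ hb₁, h.map_upper_add hφ hj ha₂ hb₂, h3,
    h.map_compl_add hφ hj ha₄ hb₄]
  abel

end Additivity

/-! ### Additive Jordan maps on a left ideal -/

section AdditiveJordan

variable {R S : Type*} [NonUnitalRing R] [NonUnitalRing S] {p : R} {φ : R → S}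

theorem jordan_map_mul_self (h2 : ∀ a : S, a + a = 0 → a = 0)
    (hadd : ∀ a b, φ (a + b) = φ a + φ b)
    (hj : ∀ a b, φ (a * b + b * a) = φ a * φ b + φ b * φ a) (a : R) :
    φ (a * a) = φ a * φ a := by
  have := hj a a
  rw [hadd] at this
  rw [← sub_eq_zero]
  apply h2
  rw [← sub_eq_zero.2 this]; abel

/-- From p∘(p∘a) = p∘a + 2pap, the corner compression is expressible by Jordan products; the same
identity holds for the idempotent φ(p). -/
theorem jordan_map_corner (h2 : ∀ a : S, a + a = 0 → a = 0)
    (hadd : ∀ a b, φ (a + b) = φ a + φ b)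
    (hj : ∀ a b, φ (a * b + b * a) = φ a * φ b + φ b * φ a) (hp : p * p = p) (a : R) :
    φ (p * a * p) = φ p * φ a * φ p := by
  have hq : φ p * φ p = φ p := by rw [← jordan_map_mul_self h2 hadd hj, hp]
  have h1 := hj p (p * a + a * p)
  rw [hj p a] at h1
  have e1 : p * (p * a + a * p) + (p * a + a * p) * p =
      (p * a + a * p) + (p * a * p + p * a * p) := by
    simp only [mul_add, add_mul, ← mul_assoc, hp]
    rw [mul_assoc a p p, hp]; abel
  have e2 : φ p * (φ p * φ a + φ a * φ p) + (φ p * φ a + φ a * φ p) * φ p =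
      (φ p * φ a + φ a * φ p) + (φ p * φ a * φ p + φ p * φ a * φ p) := by
    simp only [mul_add, add_mul, ← mul_assoc, hq]
    rw [mul_assoc (φ a) (φ p) (φ p), hq]; abel
  rw [e1, e2, hadd, hj, hadd] at h1
  rw [← sub_eq_zero]
  apply h2
  rw [← sub_eq_zero.2 (add_left_cancel h1)]; abel

/-- An additive Jordan map sends the left ideal `R p` into `S (φ p)` or into `(φ p) S`, provided
that `y (φ p) y = 0` only if `y (φ p) = 0` or `(φ p) y = 0`. -/
theorem jordan_map_mul_proj (h2 : ∀ a : S, a + a = 0 → a = 0)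
    (hadd : ∀ a b, φ (a + b) = φ a + φ b)
    (hj : ∀ a b, φ (a * b + b * a) = φ a * φ b + φ b * φ a) (hp : p * p = p)
    (hprime : ∀ y : S, y * φ p * y = 0 → y * φ p = 0 ∨ φ p * y = 0) :
    (∀ a, φ (a * p) * φ p = φ (a * p)) ∨ (∀ a, φ p * φ (a * p) = φ (a * p)) := by
  have hq : φ p * φ p = φ p := by rw [← jordan_map_mul_self h2 hadd hj, hp]
  set f : R →+ S := ⟨⟨φ, by simpa using hadd 0 0⟩, hadd⟩ with hf
  have hfφ : ∀ a, φ a = f a := fun _ => rfl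
  have hX (a : R) : φ (a * p - p * a * p) * φ p + φ p * φ (a * p - p * a * p) =
      φ (a * p - p * a * p) := by
    rw [← hj]
    congr 1
    simp only [sub_mul, mul_sub, ← mul_assoc, hp]
    rw [mul_assoc a p p, mul_assoc (p * a) p p, hp]; abel
  have hXX (a : R) : φ (a * p - p * a * p) * φ (a * p - p * a * p) = 0 := by
    rw [← jordan_map_mul_self h2 hadd hj]
    have : (a * p - p * a * p) * (a * p - p * a * p) = 0 := by
      have e : p * (a * p - p * a * p) = 0 := by
        simp only [mul_sub, ← mul_assoc, hp, sub_self]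
      have e' : (a * p - p * a * p) = (a * p - p * a * p) * p := by
        simp only [sub_mul, mul_assoc, hp]
      nth_rewrite 1 [e']
      rw [mul_assoc, e, mul_zero]
    rw [this, hfφ, map_zero]
  have hdecomp (a : R) : φ (a * p) = φ p * φ a * φ p + φ (a * p - p * a * p) := by
    rw [← jordan_map_corner h2 hadd hj hp, ← hadd]; congr 1; abel
  -- For y = φ(ap - pap), the relations y∘φ(p) = y and y² = 0 give y φ(p) y = 0.
  have halt (a : R) : φ (a * p - p * a * p) * φ p = 0 ∨ φ p * φ (a * p - p * a * p) = 0 := by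
    apply hprime
    have h1 := hX a
    have h2 := hXX a
    set y := φ (a * p - p * a * p)
    have e0 : φ p * y * φ p = 0 := by
      have := congrArg (fun z => φ p * z) h1
      simp only [mul_add, ← mul_assoc, hq] at this
      simpa using this
    have : y * y = y * φ p * y := by
      conv_lhs => rw [← h1]
      have : (y * φ p + φ p * y) * (y * φ p + φ p * y) =
        y * (φ p * y * φ p) + y * (φ p * φ p) * y + φ p * (y * y) * φ p + φ p * y * φ p * y := by
        noncomm_ring
      rw [this, h2, hq, e0]; simp
    rw [← this, h2]
  -- An additive group is not the union of two proper subgroups, so the alternative is uniform in a.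
  have hside : (∀ a, φ p * φ (a * p - p * a * p) = 0) ∨ (∀ a, φ (a * p - p * a * p) * φ p = 0) := by
    by_contra! hcon
    obtain ⟨⟨a, ha⟩, ⟨b, hb⟩⟩ := hcon
    have ha' := (halt a).resolve_right ha
    have hb' := (halt b).resolve_left hb
    have e : φ ((a + b) * p - p * (a + b) * p) =
        φ (a * p - p * a * p) + φ (b * p - p * b * p) := by
      rw [← hadd]; congr 1; noncomm_ring
    have := halt (a + b)
    rw [e, add_mul, mul_add, ha', hb', zero_add, add_zero] at this
    tauto
  rcases hside with h | h
  · left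
    intro a
    have := hX a
    rw [h, add_zero] at this
    rw [hdecomp, add_mul, this, mul_assoc _ (φ p) (φ p), hq]
  · right
    intro a
    have := hX a
    rw [h, zero_add] at this
    rw [hdecomp, mul_add, this, ← mul_assoc, ← mul_assoc, hq]

variable [StarRing R] [StarRing S]

theorem jordan_map_mul_proj_eq (h2 : ∀ a : S, a + a = 0 → a = 0)
    (hadd : ∀ a b, φ (a + b) = φ a + φ b) (hstar : ∀ a, φ (star a) = star (φ a))
    (hj : ∀ a b, φ (a * b + b * a) = φ a * φ b + φ b * φ a) (hp : p * p = p) (hps : star p = p)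
    (hside : ∀ a, φ (a * p) * φ p = φ (a * p)) (a : R) : φ (a * p) = φ a * φ p := by
  have hq : φ p * φ p = φ p := by rw [← jordan_map_mul_self h2 hadd hj, hp]
  have h1 := congrArg (fun z => z * φ p) (hj p a)
  have hside' : φ p * φ (p * a) = φ (p * a) := by
    have := congrArg star (hside (star a))
    rwa [star_mul, ← hstar, ← hstar, star_mul, star_star, hps] at this
  have e1 : φ (p * a) * φ p = φ p * φ a * φ p := by
    have := jordan_map_corner h2 hadd hj hp (p * a)
    rw [← mul_assoc, hp, hside', jordan_map_corner h2 hadd hj hp] at this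
    exact this.symm
  simp only [hadd, add_mul, e1, hside] at h1
  rw [mul_assoc (φ a), hq] at h1
  exact add_left_cancel h1

/-- Multiplicativity spreads outward: on the corner, because commuting elements have Jordan product
2ab; then for b·(pap); then for a·(bp). In the last two steps the Jordan identity is multiplied by
φ(p) on the right, and the unwanted term, already known, is cancelled. -/
theorem jordan_map_mul_mul_proj (h2 : ∀ a : S, a + a = 0 → a = 0)
    (hadd : ∀ a b, φ (a + b) = φ a + φ b) (hstar : ∀ a, φ (star a) = star (φ a))
    (hj : ∀ a b, φ (a * b + b * a) = φ a * φ b + φ b * φ a) (hp : p * p = p) (hps : star p = p)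
    (hcomm : ∀ a b, p * a * p * (p * b * p) = p * b * p * (p * a * p))
    (hcomm' : ∀ a b, φ p * a * φ p * (φ p * b * φ p) = φ p * b * φ p * (φ p * a * φ p))
    (hside : ∀ a, φ (a * p) * φ p = φ (a * p)) (a b : R) :
    φ (a * (b * p)) = φ a * φ (b * p) := by
  have hr := jordan_map_mul_proj_eq h2 hadd hstar hj hp hps hside
  have hq : φ p * φ p = φ p := by rw [← jordan_map_mul_self h2 hadd hj, hp]
  have hc := jordan_map_corner h2 hadd hj hp
  have hpp : φ (p * a * p * (p * b * p)) = φ (p * a * p) * φ (p * b * p) := by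
    have h1 := hj (p * a * p) (p * b * p)
    rw [hcomm b a, hadd, hc, hc, hcomm' (φ b) (φ a), ← sub_eq_zero] at h1
    rw [hc, hc, ← sub_eq_zero]
    apply h2
    rw [← h1]; abel
  have hright : φ (b * (p * a * p)) = φ b * φ (p * a * p) := by
    have h1 := congrArg (fun z => z * φ p) (hj b (p * a * p))
    have e1 : φ (p * a * p * b) * φ p = φ (p * a * p) * φ b * φ p := by
      have e : p * a * p * b * p = p * a * p * (p * b * p) := by
        simp only [← mul_assoc]; rw [mul_assoc (p * a) p p, hp]
      rw [← hr, e, hpp, hc, hc]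
      simp only [← mul_assoc]; rw [mul_assoc (φ p * φ a) (φ p) (φ p), hq]
    have e2 : φ (b * (p * a * p)) * φ p = φ (b * (p * a * p)) := by
      rw [← mul_assoc, hside]
    have e3 : φ (p * a * p) * φ p = φ (p * a * p) := hside _
    simp only [hadd, add_mul, e1, e2] at h1
    rw [mul_assoc (φ b), e3] at h1
    exact add_right_cancel h1
  have h1 := congrArg (fun z => z * φ p) (hj a (b * p))
  simp only [hadd, add_mul] at h1
  rw [← hr (b * p * a), mul_assoc (φ a), ← mul_assoc a b p, hside, hside] at h1
  have e : b * p * a * p = b * (p * a * p) := by simp only [mul_assoc]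
  rw [e, hright, hc, hr b] at h1
  have e' : φ b * φ p * φ a * φ p = φ b * (φ p * φ a * φ p) := by simp only [mul_assoc]
  rw [e'] at h1
  rw [← mul_assoc a, hr b]
  exact add_right_cancel h1

end AdditiveJordan

/-! ### Rank one operators in standard operator algebras -/

section Standard

open InnerProductSpace

variable {H : Type*} [NormedAddCommGroup H] [InnerProductSpace ℂ H]

theorem hasFiniteRank_rankOne (x y : H) : HasFiniteRank (rankOne ℂ x y) := by
  unfold HasFiniteRank
  have h : LinearMap.range ((rankOne ℂ x y : H →L[ℂ] H) : H →ₗ[ℂ] H) ≤ ℂ ∙ x := by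
    rintro _ ⟨z, rfl⟩
    exact Submodule.mem_span_singleton.2 ⟨_, rfl⟩
  exact Submodule.finiteDimensional_of_le h

theorem exists_orthogonal_of_one_lt_rank (hdim : 1 < Module.rank ℂ H) :
    ∃ e u : H, ‖e‖ = 1 ∧ u ≠ 0 ∧ inner ℂ e u = 0 := by
  have : Nontrivial H := rank_pos_iff_nontrivial.1 (zero_lt_one.trans hdim)
  obtain ⟨e, he⟩ := exists_norm_eq H zero_le_one
  refine ⟨e, ?_⟩
  by_contra! hcon
  refine hdim.not_ge (rank_le_one_iff.2 ⟨e, fun v => ⟨inner ℂ e v, ?_⟩⟩)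
  by_contra hv
  refine hcon (v - inner ℂ e v • e) he (fun h => hv (sub_eq_zero.1 h).symm) ?_
  simp [he]

theorem inner_sub_smul_self {e : H} (he : ‖e‖ = 1) (x : H) :
    inner ℂ e (x - inner ℂ e x • e) = 0 := by
  simp [he]

variable [CompleteSpace H] {𝒜 : NonUnitalStarSubalgebra ℂ (H →L[ℂ] H)}

/-- The rank one operator `z ↦ ⟪y, z⟫ x` as an element of a standard operator algebra. -/
noncomputable def IsStandardOperatorAlgebra.ketBra (h𝒜 : IsStandardOperatorAlgebra 𝒜) (x y : H) :
    𝒜 :=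
  ⟨rankOne ℂ x y, h𝒜 _ (hasFiniteRank_rankOne x y)⟩

theorem coe_ext {a b : 𝒜} (h : ∀ x, (a : H →L[ℂ] H) x = (b : H →L[ℂ] H) x) : a = b :=
  Subtype.ext (ContinuousLinearMap.ext h)

theorem coe_mul_apply (a b : 𝒜) (x : H) :
    ((a * b : 𝒜) : H →L[ℂ] H) x = (a : H →L[ℂ] H) ((b : H →L[ℂ] H) x) := rfl

theorem coe_star_inner_left (a : 𝒜) (x y : H) :
    inner ℂ (((star a : 𝒜) : H →L[ℂ] H) x) y = inner ℂ x ((a : H →L[ℂ] H) y) :=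
  ContinuousLinearMap.adjoint_inner_left _ _ _

theorem coe_star_inner_right (a : 𝒜) (x y : H) :
    inner ℂ x (((star a : 𝒜) : H →L[ℂ] H) y) = inner ℂ ((a : H →L[ℂ] H) x) y :=
  ContinuousLinearMap.adjoint_inner_right _ _ _

theorem eq_zero_of_add_self_eq_zero (a : 𝒜) (h : a + a = 0) : a = 0 := by
  rw [← two_smul ℂ a] at h
  exact (smul_eq_zero.1 h).resolve_left two_ne_zero

namespace IsStandardOperatorAlgebra

variable (h𝒜 : IsStandardOperatorAlgebra 𝒜)
include h𝒜

theorem ketBra_apply (x y z : H) : (h𝒜.ketBra x y : H →L[ℂ] H) z = inner ℂ y z • x := rfl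

theorem mul_ketBra (a : 𝒜) (x y : H) :
    a * h𝒜.ketBra x y = h𝒜.ketBra ((a : H →L[ℂ] H) x) y :=
  coe_ext fun z => by simp [ketBra_apply]

theorem ketBra_mul (a : 𝒜) (x y : H) :
    h𝒜.ketBra x y * a = h𝒜.ketBra x (((star a : 𝒜) : H →L[ℂ] H) y) :=
  coe_ext fun z => by rw [coe_mul_apply, ketBra_apply, ketBra_apply, coe_star_inner_left]

theorem star_ketBra (x y : H) : star (h𝒜.ketBra x y) = h𝒜.ketBra y x := by
  refine coe_ext fun z => ext_inner_left ℂ fun w => ?_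
  rw [coe_star_inner_right, ketBra_apply, ketBra_apply, inner_smul_left, inner_smul_right,
    inner_conj_symm, mul_comm]

theorem smul_ketBra (c : ℂ) (x y : H) : c • h𝒜.ketBra x y = h𝒜.ketBra (c • x) y :=
  coe_ext fun z => by
    rw [ketBra_apply, smul_comm, ← ketBra_apply h𝒜]; rfl

theorem add_ketBra (x x' y : H) : h𝒜.ketBra (x + x') y = h𝒜.ketBra x y + h𝒜.ketBra x' y :=
  coe_ext fun z => by
    rw [ketBra_apply, smul_add, ← ketBra_apply h𝒜, ← ketBra_apply h𝒜]; rfl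

theorem ketBra_eq_zero {x y : H} : h𝒜.ketBra x y = 0 ↔ x = 0 ∨ y = 0 := by
  rw [← rankOne_eq_zero (𝕜 := ℂ)]
  exact Subtype.ext_iff

theorem ketBra_mul_ketBra (x y z w : H) :
    h𝒜.ketBra x y * h𝒜.ketBra z w = (inner ℂ y z : ℂ) • h𝒜.ketBra x w := by
  rw [mul_ketBra, ketBra_apply, smul_ketBra]

theorem ketBra_mul_mul_ketBra (a : 𝒜) (e : H) :
    h𝒜.ketBra e e * a * h𝒜.ketBra e e =
      (inner ℂ e ((a : H →L[ℂ] H) e) : ℂ) • h𝒜.ketBra e e := by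
  rw [mul_assoc, mul_ketBra, ketBra_mul_ketBra]

theorem corner_comm (e : H) (a b : 𝒜) :
    h𝒜.ketBra e e * a * h𝒜.ketBra e e * (h𝒜.ketBra e e * b * h𝒜.ketBra e e) =
    h𝒜.ketBra e e * b * h𝒜.ketBra e e * (h𝒜.ketBra e e * a * h𝒜.ketBra e e) := by
  simp only [ketBra_mul_mul_ketBra, smul_mul_smul_comm, mul_comm]

theorem ketBra_idem {e : H} (he : ‖e‖ = 1) :
    h𝒜.ketBra e e * h𝒜.ketBra e e = h𝒜.ketBra e e := by
  rw [ketBra_mul_ketBra]; simp [he]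

theorem mul_ketBra_eq_self {e : H} (he : ‖e‖ = 1) {d : 𝒜}
    (hd : ∀ u, inner ℂ e u = 0 → (d : H →L[ℂ] H) u = 0) : d * h𝒜.ketBra e e = d :=
  coe_ext fun x => by
    have := hd _ (inner_sub_smul_self he x)
    rw [map_sub, sub_eq_zero, map_smul] at this
    rw [mul_ketBra, ketBra_apply, this]

/-- Evaluating at u gives ⟨u,u⟩du + ⟨u,du⟩u = 0; pairing with u shows ⟨u,du⟩ = 0, and then du = 0.
-/
theorem apply_eq_zero_of_anticomm {d : 𝒜} {u : H}
    (h : d * h𝒜.ketBra u u + h𝒜.ketBra u u * d = 0) : (d : H →L[ℂ] H) u = 0 := by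
  rcases eq_or_ne u 0 with rfl | hu
  · simp
  have hu' : (inner ℂ u u : ℂ) ≠ 0 := inner_self_ne_zero.2 hu
  have h1 : ((d * h𝒜.ketBra u u + h𝒜.ketBra u u * d : 𝒜) : H →L[ℂ] H) u = 0 := by rw [h]; rfl
  have h2 : (inner ℂ u u : ℂ) • (d : H →L[ℂ] H) u + (inner ℂ u ((d : H →L[ℂ] H) u) : ℂ) • u = 0 := by
    rw [← h1, mul_ketBra]; rfl
  have h3 := congrArg (fun z => (inner ℂ u z : ℂ)) h2
  simp only [inner_add_right, inner_smul_right, inner_zero_right] at h3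
  have h4 : (inner ℂ u ((d : H →L[ℂ] H) u) : ℂ) = 0 := by
    have : (inner ℂ u u : ℂ) * inner ℂ u ((d : H →L[ℂ] H) u) = 0 := by linear_combination h3 / 2
    exact (mul_eq_zero.1 this).resolve_left hu'
  rw [h4, zero_smul, add_zero] at h2
  exact (smul_eq_zero.1 h2).resolve_left hu'

/-- Tests run over u ⊥ e: |u⟩⟨u| shows that d and d* kill u in `corner`, and |e⟩⟨u| shows that d*
kills u in `faithful`. For `domain`, the upper corner is ℂp. For `exists_unit`, a = |e⟩⟨y| with y =
a*e ⊥ e, and q projects onto ℂy, or is 0 if y = 0. -/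
theorem isPeirceSeparating {e : H} (he : ‖e‖ = 1) : IsPeirceSeparating (h𝒜.ketBra e e) where
  idem := h𝒜.ketBra_idem he
  star_eq := h𝒜.star_ketBra e e
  proper a ha := by
    have := congrArg (Subtype.val) ha
    exact Subtype.ext ((CStarRing.star_mul_self_eq_zero_iff (a : H →L[ℂ] H)).1 this)
  eq_zero_of_add_self := eq_zero_of_add_self_eq_zero
  corner d hd := by
    have key (u : H) (hu : inner ℂ e u = 0) :
        d * h𝒜.ketBra u u + h𝒜.ketBra u u * d = 0 := by
      refine hd _ ⟨?_, ?_⟩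
      · rw [ketBra_mul_ketBra, hu, zero_smul]; rfl
      · rw [ketBra_mul_ketBra, inner_eq_zero_symm.1 hu, zero_smul]; rfl
    refine ⟨?_, h𝒜.mul_ketBra_eq_self he fun u hu => h𝒜.apply_eq_zero_of_anticomm (key u hu)⟩
    have := h𝒜.mul_ketBra_eq_self he (d := star d) fun u hu => by
      apply h𝒜.apply_eq_zero_of_anticomm
      have := congrArg star (key u hu)
      simp only [star_add, star_mul, star_ketBra, star_zero] at this
      rw [← this, add_comm]
    have := congrArg star this
    rw [cond_true]
    simpa only [star_mul, star_star, star_ketBra] using this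
  faithful d hd h := by
    rw [← star_eq_zero]
    have h1 : star d * h𝒜.ketBra e e = star d := by
      refine h𝒜.mul_ketBra_eq_self he fun u hu => ?_
      have := h (h𝒜.ketBra e u) ⟨?_, ?_⟩
      · rw [ketBra_mul, ketBra_eq_zero] at this
        refine this.resolve_left fun h0 => ?_
        simp [h0] at he
      · rw [ketBra_mul_ketBra]; simp [he]
      · rw [ketBra_mul_ketBra, inner_eq_zero_symm.1 hu, zero_smul]; rfl
    rw [← h1, ← h𝒜.star_ketBra e e, ← star_mul, hd.1]
    simp
  domain d x hd hx hdx := by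
    have h1 := h𝒜.ketBra_mul_mul_ketBra d e
    rw [hd.1, cond_true, hd.2, cond_true] at h1
    rw [h1, smul_mul_assoc, hx.1, cond_true] at hdx
    rcases smul_eq_zero.1 hdx with h0 | h0
    · left; rw [h1, h0, zero_smul]
    · exact .inr h0
  exists_unit a ha := by
    set y := ((star a : 𝒜) : H →L[ℂ] H) e with hy
    have ha' : a = h𝒜.ketBra e y := by rw [hy, ← ketBra_mul, ha.1, cond_true]
    have hye : inner ℂ e y = 0 := by
      rw [hy, coe_star_inner_right]
      have h0 : (a : H →L[ℂ] H) e = 0 := by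
        have := ha.2
        rw [mul_ketBra, cond_false, ketBra_eq_zero] at this
        exact this.resolve_right fun h0 => by simp [h0] at he
      rw [h0, inner_zero_left]
    rcases eq_or_ne y 0 with h0 | h0
    · refine ⟨0, .zero, ?_⟩
      rw [mul_zero, ha', h0, eq_comm, ketBra_eq_zero]; simp
    · refine ⟨(inner ℂ y y : ℂ)⁻¹ • h𝒜.ketBra y y, ⟨?_, ?_⟩, ?_⟩
      · rw [mul_smul_comm, ketBra_mul_ketBra, hye, zero_smul, smul_zero]; rfl
      · rw [smul_mul_assoc, ketBra_mul_ketBra, inner_eq_zero_symm.1 hye, zero_smul, smul_zero]; rfl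
      · rw [mul_smul_comm, ha', ketBra_mul_ketBra, smul_smul, inv_mul_cancel₀, one_smul]
        exact inner_self_ne_zero.2 h0

end IsStandardOperatorAlgebra

end Standard

/-- A star-preserving ring endomorphism of `ℂ` fixes the reals, hence is the identity or the
conjugation. -/
theorem eq_id_or_conj {f : ℂ → ℂ} (hf1 : f 1 = 1) (hfadd : ∀ c d, f (c + d) = f c + f d)
    (hfmul : ∀ c d, f (c * d) = f c * f d) (hfstar : ∀ c, f (star c) = star (f c)) :
    (∀ r : ℝ, f r = r) ∧ (f = id ∨ f = starRingEnd ℂ) := by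
  let F : ℂ →+* ℂ :=
    { toFun := f
      map_one' := hf1
      map_mul' := hfmul
      map_zero' := by simpa using hfadd 0 0
      map_add' := hfadd }
  -- Commuting with conjugation makes f preserve ℝ, whose only ring endomorphism is the identity; no
  -- continuity is needed.
  have hreal (r : ℝ) : f r = r := by
    have him (r : ℝ) : ((f r).re : ℂ) = f r := by
      rw [← Complex.conj_eq_iff_re]
      have := hfstar r
      rw [← starRingEnd_apply, ← starRingEnd_apply, Complex.conj_ofReal] at this
      exact this.symm
    let G : ℝ →+* ℝ :=
      { toFun := fun r => (f r).re
        map_one' := by simp [hf1]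
        map_mul' := fun x y => by
          apply Complex.ofReal_injective
          rw [him, Complex.ofReal_mul, Complex.ofReal_mul, him, him, hfmul]
        map_zero' := by
          have : f 0 = 0 := by simpa using hfadd 0 0
          simp [this]
        map_add' := fun x y => by simp [hfadd] }
    have hG : G = RingHom.id ℝ := Subsingleton.elim _ _
    rw [← him]
    exact congrArg _ (congrArg (fun g : ℝ →+* ℝ => g r) hG)
  refine ⟨hreal, ?_⟩
  rcases Complex.real_algHom_eq_id_or_conj { F with commutes' := hreal } with h | h
  · exact .inl (congrArg (fun g : ℂ →ₐ[ℝ] ℂ => (g : ℂ → ℂ)) h)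
  · exact .inr (congrArg (fun g : ℂ →ₐ[ℝ] ℂ => (g : ℂ → ℂ)) h)

/-! ### Construction of the implementing isometry -/

section Implementation

open InnerProductSpace

variable {H K : Type*} [NormedAddCommGroup H] [InnerProductSpace ℂ H] [CompleteSpace H]
  [NormedAddCommGroup K] [InnerProductSpace ℂ K] [CompleteSpace K]
  {𝒜 : NonUnitalStarSubalgebra ℂ (H →L[ℂ] H)} {ℬ : NonUnitalStarSubalgebra ℂ (K →L[ℂ] K)}

/-- A self-adjoint idempotent whose corner has no anticommuting zero divisors has rank one. -/
theorem IsStandardOperatorAlgebra.exists_eq_ketBra (hℬ : IsStandardOperatorAlgebra ℬ) {q : ℬ}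
    (hq : q * q = q) (hqs : star q = q) (hq0 : q ≠ 0)
    (hmin : ∀ a b : ℬ, IsPeirce q true true a → IsPeirce q true true b →
      a * b + b * a = 0 → a = 0 ∨ b = 0) :
    ∃ e : K, ‖e‖ = 1 ∧ q = hℬ.ketBra e e := by
  have hqq (x : K) : (q : K →L[ℂ] K) ((q : K →L[ℂ] K) x) = (q : K →L[ℂ] K) x := by
    rw [← coe_mul_apply, hq]
  have hpeirce (x : K) (hx : (q : K →L[ℂ] K) x = x) : IsPeirce q true true (hℬ.ketBra x x) := by
    refine ⟨?_, ?_⟩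
    · rw [hℬ.mul_ketBra, hx, cond_true]
    · rw [hℬ.ketBra_mul, hqs, hx, cond_true]
  -- Orthogonal x, y in the range of q give projectors up to scale with zero product, so the range
  -- contains no two nonzero orthogonal vectors.
  have horth (x y : K) (hx : (q : K →L[ℂ] K) x = x) (hy : (q : K →L[ℂ] K) y = y)
      (hxy : inner ℂ x y = 0) : x = 0 ∨ y = 0 := by
    have := hmin _ _ (hpeirce x hx) (hpeirce y hy) (by
      rw [hℬ.ketBra_mul_ketBra, hℬ.ketBra_mul_ketBra, hxy, inner_eq_zero_symm.1 hxy, zero_smul,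
        zero_smul, add_zero])
    simpa [hℬ.ketBra_eq_zero] using this
  obtain ⟨w, hw⟩ : ∃ w, (q : K →L[ℂ] K) w ≠ 0 := by
    by_contra! h
    exact hq0 (coe_ext h)
  set v := (q : K →L[ℂ] K) w with hv
  have hqv : (q : K →L[ℂ] K) v = v := hqq w
  set e : K := (‖v‖⁻¹ : ℂ) • v with he
  have he1 : ‖e‖ = 1 := by
    rw [he, norm_smul, norm_inv, Complex.norm_real, norm_norm,
      inv_mul_cancel₀ (norm_ne_zero_iff.2 hw)]
  have hqe : (q : K →L[ℂ] K) e = e := by rw [he, map_smul, hqv]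
  have he0 : e ≠ 0 := fun h => by simp [h] at he1
  refine ⟨e, he1, coe_ext fun x => ?_⟩
  rw [hℬ.ketBra_apply, ← sub_eq_zero]
  have hin : (inner ℂ e ((q : K →L[ℂ] K) x) : ℂ) = inner ℂ e x := by
    rw [← coe_star_inner_left, hqs, hqe]
  refine (horth e _ hqe ?_ ?_).resolve_left he0
  · rw [map_sub, hqq, map_smul, hqe]
  · rw [← hin, inner_sub_smul_self he1]

set_option maxHeartbeats 800000 in
/-- An additive star-preserving Jordan bijection that maps a left ideal generated by a rank one
projection into the corresponding left ideal is implemented by an isometric bijection which is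
linear or conjugate-linear. -/
theorem exists_implementing_map (h𝒜 : IsStandardOperatorAlgebra 𝒜)
    (hℬ : IsStandardOperatorAlgebra ℬ) {φ : 𝒜 → ℬ} (hφ : Function.Surjective φ)
    (hadd : ∀ a b, φ (a + b) = φ a + φ b) (hstar : ∀ a, φ (star a) = star (φ a))
    (hj : ∀ a b, φ (a * b + b * a) = φ a * φ b + φ b * φ a) {e : H} {e' : K}
    (he : ‖e‖ = 1) (he' : ‖e'‖ = 1) (hp : φ (h𝒜.ketBra e e) = hℬ.ketBra e' e')
    (hside : ∀ a, φ (a * h𝒜.ketBra e e) * φ (h𝒜.ketBra e e) = φ (a * h𝒜.ketBra e e)) :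
    ∃ (f : ℂ → ℂ) (U : H → K), (f = id ∨ f = starRingEnd ℂ) ∧ (∀ x y, U (x + y) = U x + U y) ∧
      (∀ (c : ℂ) x, U (c • x) = f c • U x) ∧ (∀ x, ‖U x‖ = ‖x‖) ∧ Function.Surjective U ∧
      ∀ (a : 𝒜) x, (φ a : K →L[ℂ] K) (U x) = U ((a : H →L[ℂ] H) x) := by
  have h2 := eq_zero_of_add_self_eq_zero (𝒜 := ℬ)
  have hidem := h𝒜.ketBra_idem he
  have hpstar := h𝒜.star_ketBra e e
  have hcorner := jordan_map_corner h2 hadd hj hidem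
  have hmul := jordan_map_mul_mul_proj h2 hadd hstar hj hidem hpstar (h𝒜.corner_comm e)
    (by rw [hp]; exact hℬ.corner_comm e') hside
  have hketBra (x : H) : h𝒜.ketBra x e * h𝒜.ketBra e e = h𝒜.ketBra x e := by
    rw [h𝒜.ketBra_mul_ketBra]; simp [he]
  have hmulket (a : 𝒜) (x : H) : φ (a * h𝒜.ketBra x e) = φ a * φ (h𝒜.ketBra x e) := by
    rw [← hketBra, hmul]
  have hpe : (hℬ.ketBra e' e' : K →L[ℂ] K) e' = e' := by rw [hℬ.ketBra_apply]; simp [he']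
  obtain ⟨f, hfφ⟩ : ∃ f : ℂ → ℂ, ∀ c, φ (c • h𝒜.ketBra e e) = f c • hℬ.ketBra e' e' := by
    refine ⟨fun c => inner ℂ e' ((φ (c • h𝒜.ketBra e e) : K →L[ℂ] K) e'), fun c => ?_⟩
    have := hcorner (c • h𝒜.ketBra e e)
    rw [mul_smul_comm, hidem, smul_mul_assoc, hidem, hp, hℬ.ketBra_mul_mul_ketBra] at this
    exact this
  have heval (c : ℂ) :
      (inner ℂ e' (((c • hℬ.ketBra e' e' : ℬ) : K →L[ℂ] K) e') : ℂ) = c := by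
    change (inner ℂ e' (c • (hℬ.ketBra e' e' : K →L[ℂ] K) e') : ℂ) = c
    simp [hpe, he']
  have hfinj {c d : ℂ} (h : c • hℬ.ketBra e' e' = d • hℬ.ketBra e' e') : c = d := by
    rw [← heval c, h, heval]
  have hf1 : f 1 = 1 := hfinj (by rw [← hfφ, one_smul, one_smul, hp])
  have hfadd (c d : ℂ) : f (c + d) = f c + f d :=
    hfinj (by rw [← hfφ, add_smul, hadd, hfφ, hfφ, add_smul])
  have hfmul (c d : ℂ) : f (c * d) = f c * f d := hfinj (by
    have := hmul (c • h𝒜.ketBra e e) (d • h𝒜.ketBra e e)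
    rw [smul_mul_assoc d, hidem, smul_mul_smul_comm, hidem, hfφ, hfφ, hfφ, smul_mul_smul_comm,
      hℬ.ketBra_idem he'] at this
    exact this)
  have hfstar (c : ℂ) : f (star c) = star (f c) := hfinj (by
    rw [← hfφ, ← hpstar, ← star_smul, hstar, hfφ, star_smul, hℬ.star_ketBra])
  obtain ⟨hreal, hfid⟩ := eq_id_or_conj hf1 hfadd hfmul hfstar
  -- U x = φ(|x⟩⟨e|)e'. Multiplicativity on the left ideal gives φ(a)Ux = φ(|ax⟩⟨e|)e' = U(ax), and
  -- ⟨Ux,Ux⟩ = f(⟨x,x⟩) = ‖x‖² since f fixes the reals.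
  refine ⟨f, fun x => (φ (h𝒜.ketBra x e) : K →L[ℂ] K) e', hfid, ?_, ?_, ?_, ?_, ?_⟩
  · intro x y
    beta_reduce
    rw [h𝒜.add_ketBra, hadd]; rfl
  · intro c x
    have : h𝒜.ketBra (c • x) e = h𝒜.ketBra x e * (c • h𝒜.ketBra e e * h𝒜.ketBra e e) := by
      rw [smul_mul_assoc c, hidem, mul_smul_comm c, hketBra, h𝒜.smul_ketBra]
    beta_reduce
    rw [this, hmul, smul_mul_assoc c, hidem, hfφ, coe_mul_apply]
    change (φ (h𝒜.ketBra x e) : K →L[ℂ] K) (f c • (hℬ.ketBra e' e' : K →L[ℂ] K) e') = _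
    rw [hpe, map_smul]
  · intro x
    have h1 : (inner ℂ ((φ (h𝒜.ketBra x e) : K →L[ℂ] K) e')
        ((φ (h𝒜.ketBra x e) : K →L[ℂ] K) e') : ℂ) = f (inner ℂ x x) := by
      rw [← coe_star_inner_right, ← coe_mul_apply, ← hstar, ← hmulket, h𝒜.star_ketBra,
        h𝒜.ketBra_mul_ketBra, hfφ, heval]
    rw [inner_self_eq_norm_sq_to_K, inner_self_eq_norm_sq_to_K] at h1
    have h3 : f (((‖x‖ ^ 2 : ℝ) : ℂ)) = ((‖x‖ ^ 2 : ℝ) : ℂ) := hreal _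
    push_cast at h3
    have h4 : ‖(φ (h𝒜.ketBra x e) : K →L[ℂ] K) e'‖ ^ 2 = ‖x‖ ^ 2 := by
      exact Complex.ofReal_injective (by push_cast; exact h1.trans h3)
    exact (sq_eq_sq₀ (norm_nonneg _) (norm_nonneg _)).1 h4
  · intro z
    obtain ⟨b, hb⟩ := hφ (hℬ.ketBra z e')
    -- With φ(b) = |z⟩⟨e'|, the vector be works: U(be) = φ(bp)e' = φ(b)φ(p)e' = z.
    refine ⟨(b : H →L[ℂ] H) e, ?_⟩
    change (φ (h𝒜.ketBra ((b : H →L[ℂ] H) e) e) : K →L[ℂ] K) e' = z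
    rw [← h𝒜.mul_ketBra, hmulket, hb, hp, coe_mul_apply, hpe, hℬ.ketBra_apply]
    simp [he']
  · intro a x
    change (φ a : K →L[ℂ] K) ((φ (h𝒜.ketBra x e) : K →L[ℂ] K) e') = _
    rw [← coe_mul_apply, ← hmulket, h𝒜.mul_ketBra]

theorem exists_unitaryConj_or_antiunitaryConj {φ : 𝒜 → ℬ}
    (h : ∃ (f : ℂ → ℂ) (U : H → K), (f = id ∨ f = starRingEnd ℂ) ∧
      (∀ x y, U (x + y) = U x + U y) ∧
      (∀ (c : ℂ) x, U (c • x) = f c • U x) ∧ (∀ x, ‖U x‖ = ‖x‖) ∧ Function.Surjective U ∧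
      ∀ (a : 𝒜) x, (φ a : K →L[ℂ] K) (U x) = U ((a : H →L[ℂ] H) x)) :
    (∃ U : H ≃ₗᵢ[ℂ] K, ∀ a : 𝒜, (φ a : K →L[ℂ] K) = unitaryConj U (a : H →L[ℂ] H)) ∨
      (∃ U : H ≃ₗᵢ⋆[ℂ] K, ∀ a : 𝒜,
        (φ a : K →L[ℂ] K) = antiunitaryConj U (a : H →L[ℂ] H)) := by
  obtain ⟨f, U, rfl | rfl, hadd, hsmul, hnorm, hsurj, hU⟩ := h
  · left
    let V : H →ₗᵢ[ℂ] K := ⟨⟨⟨U, hadd⟩, hsmul⟩, hnorm⟩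
    refine ⟨LinearIsometryEquiv.ofSurjective V hsurj, fun a => ContinuousLinearMap.ext fun y => ?_⟩
    obtain ⟨x, rfl⟩ := (LinearIsometryEquiv.ofSurjective V hsurj).surjective y
    refine (hU a x).trans ?_
    simp only [unitaryConj, ContinuousLinearMap.comp_apply]
    change _ = (LinearIsometryEquiv.ofSurjective V hsurj) ((a : H →L[ℂ] H)
      ((LinearIsometryEquiv.ofSurjective V hsurj).symm _))
    rw [LinearIsometryEquiv.symm_apply_apply]
    rfl
  · right
    let V : H →ₛₗᵢ[starRingEnd ℂ] K := ⟨⟨⟨U, hadd⟩, hsmul⟩, hnorm⟩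
    refine ⟨LinearIsometryEquiv.ofSurjective V hsurj, fun a => ContinuousLinearMap.ext fun y => ?_⟩
    obtain ⟨x, rfl⟩ := (LinearIsometryEquiv.ofSurjective V hsurj).surjective y
    refine (hU a x).trans ?_
    simp only [antiunitaryConj, ContinuousLinearMap.comp_apply]
    change _ = (LinearIsometryEquiv.ofSurjective V hsurj) ((a : H →L[ℂ] H)
      ((LinearIsometryEquiv.ofSurjective V hsurj).symm _))
    rw [LinearIsometryEquiv.symm_apply_apply]
    rfl

end Implementation

/-! ### Assembly: the left ideal case and its adjoint -/

theorem theorem2 {H K : Type*}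
    [NormedAddCommGroup H] [InnerProductSpace ℂ H] [CompleteSpace H]
    [NormedAddCommGroup K] [InnerProductSpace ℂ K] [CompleteSpace K]
    (hdim : 1 < Module.rank ℂ H)
    (𝒜 : NonUnitalStarSubalgebra ℂ (H →L[ℂ] H)) (h𝒜 : IsStandardOperatorAlgebra 𝒜)
    (ℬ : NonUnitalStarSubalgebra ℂ (K →L[ℂ] K)) (hℬ : IsStandardOperatorAlgebra ℬ)
    (φ : 𝒜 → ℬ) (hφ : Function.Bijective φ)
    (hstar : ∀ A : 𝒜, φ (star A) = star (φ A))
    (hjordan : ∀ A B : 𝒜, φ (A * B + B * A) = φ A * φ B + φ B * φ A) :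
    ((∃ U : H ≃ₗᵢ[ℂ] K, ∀ A : 𝒜, (φ A : K →L[ℂ] K) = unitaryConj U (A : H →L[ℂ] H)) ∨
      (∃ U : H ≃ₗᵢ⋆[ℂ] K, ∀ A : 𝒜, (φ A : K →L[ℂ] K) = antiunitaryConj U (A : H →L[ℂ] H)) ∨
      (∃ U : H ≃ₗᵢ[ℂ] K, ∀ A : 𝒜,
        (φ A : K →L[ℂ] K) = unitaryConj U (ContinuousLinearMap.adjoint (A : H →L[ℂ] H))) ∨
      (∃ U : H ≃ₗᵢ⋆[ℂ] K, ∀ A : 𝒜,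
        (φ A : K →L[ℂ] K) = antiunitaryConj U (ContinuousLinearMap.adjoint (A : H →L[ℂ] H)))) ∧
    (∀ A B : 𝒜, φ (A + B) = φ A + φ B) := by
  obtain ⟨e, u, he, hu, heu⟩ := exists_orthogonal_of_one_lt_rank hdim
  have he0 : e ≠ 0 := fun h => by simp [h] at he
  have hsep := h𝒜.isPeirceSeparating he
  have h2 := eq_zero_of_add_self_eq_zero (𝒜 := ℬ)
  have hadd := hsep.map_add hφ hstar hjordan ⟨h𝒜.ketBra e u, ⟨by
    rw [h𝒜.ketBra_mul_ketBra]; simp [he], by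
    rw [h𝒜.ketBra_mul_ketBra, inner_eq_zero_symm.1 heu, zero_smul]; rfl⟩,
    fun h => (h𝒜.ketBra_eq_zero.1 h).elim he0 hu⟩
  refine ⟨?_, hadd⟩
  have h0 := jordan_map_zero hφ hjordan
  have hcorner := jordan_map_corner h2 hadd hjordan hsep.idem
  have hq : φ (h𝒜.ketBra e e) * φ (h𝒜.ketBra e e) = φ (h𝒜.ketBra e e) := by
    rw [← jordan_map_mul_self h2 hadd hjordan, hsep.idem]
  have hqs : star (φ (h𝒜.ketBra e e)) = φ (h𝒜.ketBra e e) := by rw [← hstar, hsep.star_eq]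
  obtain ⟨e', he', hp⟩ := hℬ.exists_eq_ketBra hq hqs
    (fun h => (h𝒜.ketBra_eq_zero.1 (hφ.1 (h.trans h0.symm))).elim he0 he0) (by
      -- The corner of φ(p) is φ(ℂp), so a vanishing Jordan product there pulls back to 2cd p = 0 in
      -- ℂp.
      have key (b : ℬ) (hb : IsPeirce (φ (h𝒜.ketBra e e)) true true b) :
          ∃ c : ℂ, b = φ (c • h𝒜.ketBra e e) := by
        obtain ⟨a, rfl⟩ := hφ.2 b
        refine ⟨inner ℂ e ((a : H →L[ℂ] H) e), ?_⟩
        rw [← h𝒜.ketBra_mul_mul_ketBra, hcorner, hb.1, cond_true, hb.2, cond_true]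
      intro a b ha hb hab
      obtain ⟨c, rfl⟩ := key a ha
      obtain ⟨d, rfl⟩ := key b hb
      rw [← hjordan, ← h0] at hab
      have := hφ.1 hab
      rw [smul_mul_smul_comm, smul_mul_smul_comm, hsep.idem, mul_comm d c] at this
      rcases smul_eq_zero.1 (hsep.eq_zero_of_add_self _ this) with h | h
      · rcases mul_eq_zero.1 h with rfl | rfl
        · left; rw [zero_smul, h0]
        · right; rw [zero_smul, h0]
      · exact ((h𝒜.ketBra_eq_zero.1 h).elim he0 he0).elim)
  -- As φ(p) = |e'⟩⟨e'|, the product yφ(p)y is |ye'⟩⟨y*e'|, which vanishes only if ye' = 0 or y*e' =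
  -- 0.
  have hprime (y : ℬ) (hy : y * φ (h𝒜.ketBra e e) * y = 0) :
      y * φ (h𝒜.ketBra e e) = 0 ∨ φ (h𝒜.ketBra e e) * y = 0 := by
    rw [hp, hℬ.mul_ketBra, hℬ.ketBra_mul, hℬ.ketBra_eq_zero] at hy
    rw [hp, hℬ.mul_ketBra, hℬ.ketBra_mul, hℬ.ketBra_eq_zero, hℬ.ketBra_eq_zero]
    tauto
  rcases jordan_map_mul_proj h2 hadd hjordan hsep.idem hprime with hside | hside
  · rcases exists_unitaryConj_or_antiunitaryConj
      (exists_implementing_map h𝒜 hℬ hφ.2 hadd hstar hjordan he he' hp hside) with h | h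
    · exact .inl h
    · exact .inr (.inl h)
  -- The map a ↦ φ(a*) is again an additive Jordan star map, and taking adjoints turns the right
  -- ideal condition into the left ideal one.
  · have himpl := exists_implementing_map h𝒜 hℬ (φ := fun a => φ (star a))
      (hφ.2.comp star_involutive.surjective) (fun a b => by rw [star_add, hadd]) (fun a => hstar _)
      (fun a b => by
        rw [← hjordan, star_add, star_mul, star_mul, add_comm])
      he he' (by rw [hsep.star_eq, hp]) (fun a => by
        have := congrArg star (hside a)
        rwa [star_mul, ← hstar, ← hstar] at this)
    rcases exists_unitaryConj_or_antiunitaryConj himpl with ⟨U, hU⟩ | ⟨U, hU⟩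
    · refine .inr (.inr (.inl ⟨U, fun a => ?_⟩))
      have := hU (star a)
      rwa [star_star] at this
    · refine .inr (.inr (.inr ⟨U, fun a => ?_⟩))
      have := hU (star a)
      rwa [star_star] at this
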